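/- **Setting.** Let $d\ge 0$, $n\ge 1$. For each $i\in\{1,\dots,d\}$ let $a_{i0}<a_{i1}<\dots<a_{in}$ be real numbers, and let $0=\tau(i,0)<\tau(i,1)<\dots<\tau(i,l_i)=n$ be integers. Let $X\subseteq\mathbb R^m$, let $f=(f_1,\dots,f_d):\mathbb R^m\to\mathbb R^d$ satisfy $a_{i0}\le f_i(x)\le a_{in}$ for all $x\in X$ and all $i$, and let $\phi:\mathbb R^d\to\mathbb R$ be any function. Let $u:\mathbb R^m\to\mathbb R^{d\times(n+1)}$ satisfy, for all $x\in X$, $1\le i\le d$ and $0\le j\le n$, $$u_{ij}(x)\le\min\{f_i(x),a_{ij}\},\qquad u_{i0}(x)=a_{i0},\qquad u_{in}(x)=f_i(x).$$ Let $W\subseteq\mathbb R^m\times\mathbb R^d$ contain $\{(x,f(x)) : x\in X\}$. For a convex set $S$ and $g:S\to[-\infty,+\infty]$, let $\operatorname{conc}_S(g)$ be the concave envelope of $g$ over $S$, i.e. the pointwise smallest concave $[-\infty,+\infty]$-valued function on $S$ that is at least $g$. Let $Q=\prod_{i=1}^dQ_i$, where $Q_i\subset\mathbb R^{n+1}$ is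 the simplex with vertices $v_{ij}=(a_{i0},\dots,a_{i,j-1},a_{ij},\dots,a_{ij})$, $j=0,\dots,n$. For $s\in\mathbb R^{d\times(n+1)}$ write $s_{\cdot n}=(s_{1n},\dots,s_{dn})$ and $\bar\phi(s)=\phi(s_{\cdot n})$. Let $Z(s)=z$, where $z_{i0}=1$ and $z_{ij}=\frac{s_{ij}-s_{i,j-1}}{a_{ij}-a_{i,j-1}}$ for $1\le j\le n$. Say that $(z,\delta)$ satisfies (Inc) if, for all $i$, $1=z_{i0}\ge z_{i1}\ge\dots\ge z_{in}\ge 0$, and $\delta_{it}\in\{0,1\}$ and $z_{i\tau(i,t)}\ge\delta_{it}\ge z_{i,\tau(i,t)+1}$ for $t=1,\dots,l_i-1$. For $(x,y)\in\mathbb R^m\times\mathbb R^d$ define (with the value $-\infty$ when there is no feasible point) $$\begin{aligned} \varphi(x,y)&=\max\{\operatorname{conc}_Q(\bar\phi)(s) : s\in Q,\ s_{\cdot n}=y,\ u(x)\le s,\ (x,y)\in W\},\\ \varphi_{\mathcal H-}(x,y)&=\max\{\operatorname{conc}_Q(\bar\phi)(s) : s\in Q,\ s_{\cdot n}=y,\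 (Z(s),\delta)\text{ satisfies (Inc) for some }\delta,\ (x,y)\in W\},\\ \varphi_{\mathcal H}(x,y)&=\max\{\operatorname{conc}_Q(\bar\phi)(s) : s\in Q,\ s_{\cdot n}=y,\ (Z(s),\delta)\text{ satisfies (Inc) for some }\delta,\ u(x)\le s,\ (x,y)\in W\} \end{aligned}$$ (suprema in general; that they are attained is part of the claim). For $w_i\in[-\infty,\infty)^{n+1}$ let $\xi_{i,a_i}(\cdot\,;w_i)$ be the function on $[a_{i0},a_{in}]$ with value $w_{ij}$ at $a_{ij}$ for $j=0,\dots,n$ and $-\infty$ elsewhere, and let $\operatorname{conc}(\xi_{i,a_i})(\cdot\,;w_i)$ be its concave envelope over $[a_{i0},a_{in}]$. **Proposition.** Let $(\bar x,\bar f)\in W$, and let $\bar t\in\prod_i\{1,\dots,l_i\}$ be such that $\bar f_i\in[a_{i\tau(i,\bar t_i-1)},a_{i\tau(i,\bar t_i)}]$ for all $i$. Define $$\bar u_{ij}=\begin{cases}\bar f_i & j=n\\ u_{ij}(\bar x)& j<n\end{cases},\qquad \hat u_{ij}=\begin{cases}a_{ij}& j\le\tau(i,\bar t_i-1)\\ \bar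 f_i& j\ge\tau(i,\bar t_i)\\ -\infty&\text{otherwise}\end{cases},\qquad u^*_{ij}=\max\{\bar u_{ij},\hat u_{ij}\}.$$ Then $\bar s_{ij}=\operatorname{conc}(\xi_{i,a_i})(a_{ij};\bar u_i)$, $\hat s_{ij}=\operatorname{conc}(\xi_{i,a_i})(a_{ij};\hat u_i)$ and $s^*_{ij}=\operatorname{conc}(\xi_{i,a_i})(a_{ij};u^*_i)$ are real numbers for all $i,j$, the maximum defining $\varphi_{\mathcal H-}(\bar x,\bar f)$ is attained, and $$\varphi_{\mathcal H-}(\bar x,\bar f)=\operatorname{conc}_Q(\bar\phi)(\hat s).$$ If moreover the underestimators are valid at $(\bar x,\bar f)$, i.e. $u_{i0}(\bar x)=a_{i0}$ and $u_{ij}(\bar x)\le\min\{a_{ij},\bar f_i\}$ for all $i,j$ (which holds whenever $\bar x\in X$ and $f(\bar x)\le\bar f$), then the maxima defining $\varphi(\bar x,\bar f)$ and $\varphi_{\mathcal H}(\bar x,\bar f)$ are attained too, and $$\varphi(\bar x,\bar f)=\operatorname{conc}_Q(\bar\phi)(\bar s),\qquad \varphi_{\mathcal H}(\bar x,\bar f)=\operatorname{conc}_Q(\bar\phi)(s^*).$$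 In all cases $\varphi_{\mathcal H}(\bar x,\bar f)\le\varphi(\bar x,\bar f)$ and $\varphi_{\mathcal H}(\bar x,\bar f)\le\varphi_{\mathcal H-}(\bar x,\bar f)$. -/

import Mathlib

noncomputable section

/-- An extended-real-valued function `g` is concave on `S` if its hypograph over `S`
is a convex set (this is the usual notion, and it allows the values `-∞` and `+∞`). -/
def EConcaveOn {E : Type*} [AddCommGroup E] [Module ℝ E] (S : Set E) (g : E → EReal) : Prop :=
  Convex ℝ {p : E × ℝ | p.1 ∈ S ∧ (p.2 : EReal) ≤ g p.1}

/-- The concave envelope `conc_S(f)`: the pointwise infimum of all concave functions on `S`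
that overestimate `f` on `S`. For `x ∉ S` its value is `-∞`. -/
def conc {E : Type*} [AddCommGroup E] [Module ℝ E] (S : Set E) (f : E → EReal) (x : E) : EReal :=
  sInf {r : EReal | ∃ g : E → EReal, EConcaveOn S g ∧ (∀ y ∈ S, f y ≤ g y) ∧ r = g x}

/-- A discretization scheme: grid points `a_{i0} < ⋯ < a_{in}` for each coordinate `i`, and a
subsequence `τ(i,0) = 0 < τ(i,1) < ⋯ < τ(i,l_i) = n` of the indices. The range box of the inner
function is `∏ᵢ [a_{i0}, a_{in}]`, and it is subdivided into the boxes
`∏ᵢ [a_{iτ(i,tᵢ-1)}, a_{iτ(i,tᵢ)}]`, `1 ≤ tᵢ ≤ l_i`. -/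
structure DiscretizationScheme (d n : ℕ) where
  a : Fin d → Fin (n + 1) → ℝ
  a_strictMono : ∀ i, StrictMono (a i)
  l : Fin d → ℕ
  τ : (i : Fin d) → Fin (l i + 1) → Fin (n + 1)
  τ_strictMono : ∀ i, StrictMono (τ i)
  τ_zero : ∀ i, τ i 0 = 0
  τ_last : ∀ i, τ i (Fin.last (l i)) = Fin.last n

/-- The ordered outer-approximation conditions for the underestimators `u` of the inner
function `f` over `X`, with constant bounding functions `a`. -/
structure OrderedOA {m d n : ℕ} (D : DiscretizationScheme d n) (X : Set (Fin m → ℝ))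
    (f : (Fin m → ℝ) → Fin d → ℝ) (u : (Fin m → ℝ) → Fin d → Fin (n + 1) → ℝ) : Prop where
  f_mem : ∀ x ∈ X, ∀ i, f x i ∈ Set.Icc (D.a i 0) (D.a i (Fin.last n))
  u_le : ∀ x ∈ X, ∀ i j, u x i j ≤ min (f x i) (D.a i j)
  u_zero : ∀ x ∈ X, ∀ i, u x i 0 = D.a i 0
  u_last : ∀ x ∈ X, ∀ i, u x i (Fin.last n) = f x i

namespace DiscretizationScheme

variable {m d n : ℕ} (D : DiscretizationScheme d n)

/-- The vertex `v_{ij} = (a_{i0}, …, a_{i,j-1}, a_{ij}, …, a_{ij})` of `Q_i`. -/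
def vert (i : Fin d) (j : Fin (n + 1)) : Fin (n + 1) → ℝ := fun k => D.a i (min k j)

/-- `Q = ∏ᵢ Q_i`, where `Q_i = conv {v_{i0}, …, v_{in}}`. -/
def Q : Set (Fin d → Fin (n + 1) → ℝ) :=
  {s | ∀ i, s i ∈ convexHull ℝ (Set.range (D.vert i))}

/-- The map `Z`: `z_{i0} = 1` and `z_{ij} = (s_{ij} - s_{i,j-1}) / (a_{ij} - a_{i,j-1})`. -/
def Z (s : Fin d → Fin (n + 1) → ℝ) : Fin d → Fin (n + 1) → ℝ := fun i =>
  Fin.cons 1 fun j : Fin n =>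
    (s i j.succ - s i j.castSucc) / (D.a i j.succ - D.a i j.castSucc)

/-- Indices `t ∈ {1, …, l_i - 1}` of the binary variables `δ_{it}`. -/
abbrev BinIdx (i : Fin d) : Type := {t : Fin (D.l i + 1) // 0 < t ∧ t < Fin.last (D.l i)}

/-- The incremental formulation: `1 = z_{i0} ≥ z_{i1} ≥ ⋯ ≥ z_{in} ≥ 0`, `δ_{it} ∈ {0,1}` and
`z_{iτ(i,t)} ≥ δ_{it} ≥ z_{i,τ(i,t)+1}` for `t = 1, …, l_i - 1`. -/
def Incremental (z : Fin d → Fin (n + 1) → ℝ) (δ : (i : Fin d) → D.BinIdx i → ℝ) : Prop :=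
  ∀ i, (z i 0 = 1 ∧ Antitone (z i) ∧ 0 ≤ z i (Fin.last n)) ∧
    ∀ t : D.BinIdx i, (δ i t = 0 ∨ δ i t = 1) ∧ δ i t ≤ z i (D.τ i t.1) ∧
      ∀ j : Fin (n + 1), (j : ℕ) = (D.τ i t.1 : ℕ) + 1 → z i j ≤ δ i t

/-- The function `conc_Q(φ̄)`, where `φ̄(s) = φ(s_{1n}, …, s_{dn})`. -/
def concQ (φ : (Fin d → ℝ) → ℝ) (s : Fin d → Fin (n + 1) → ℝ) : EReal :=
  conc D.Q (fun s' => ((φ fun i => s' i (Fin.last n) : ℝ) : EReal)) s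

/-- Feasible points of the problem defining `φ(x, y)`: `s ∈ Q`, `s_{·n} = y`, `u(x) ≤ s`,
`(x, s_{·n}) ∈ W`. -/
def feas (u : (Fin m → ℝ) → Fin d → Fin (n + 1) → ℝ) (W : Set ((Fin m → ℝ) × (Fin d → ℝ)))
    (x : Fin m → ℝ) (y : Fin d → ℝ) : Set (Fin d → Fin (n + 1) → ℝ) :=
  {s | s ∈ D.Q ∧ (∀ i, s i (Fin.last n) = y i) ∧ u x ≤ s ∧ (x, y) ∈ W}

/-- Feasible points of the problem defining `φ_{H-}(x, y)`: `s ∈ Q`, `s_{·n} = y`, `(Z(s), δ)` is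
in the incremental formulation for some `δ`, `(x, s_{·n}) ∈ W`. -/
def feasHMinus (W : Set ((Fin m → ℝ) × (Fin d → ℝ)))
    (x : Fin m → ℝ) (y : Fin d → ℝ) : Set (Fin d → Fin (n + 1) → ℝ) :=
  {s | s ∈ D.Q ∧ (∀ i, s i (Fin.last n) = y i) ∧ (∃ δ, D.Incremental (D.Z s) δ) ∧ (x, y) ∈ W}

/-- Feasible points of the problem defining `φ_H(x, y)`: both families of constraints. -/
def feasH (u : (Fin m → ℝ) → Fin d → Fin (n + 1) → ℝ) (W : Set ((Fin m → ℝ) × (Fin d → ℝ)))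
    (x : Fin m → ℝ) (y : Fin d → ℝ) : Set (Fin d → Fin (n + 1) → ℝ) :=
  {s | s ∈ D.Q ∧ (∀ i, s i (Fin.last n) = y i) ∧ (∃ δ, D.Incremental (D.Z s) δ) ∧
    u x ≤ s ∧ (x, y) ∈ W}

/-- The continuous relaxation `φ(x, y)` with underestimators (`-∞` if infeasible). -/
def relax (φ : (Fin d → ℝ) → ℝ) (u : (Fin m → ℝ) → Fin d → Fin (n + 1) → ℝ)
    (W : Set ((Fin m → ℝ) × (Fin d → ℝ))) (x : Fin m → ℝ) (y : Fin d → ℝ) : EReal :=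
  sSup (D.concQ φ '' D.feas u W x y)

/-- The discretized relaxation `φ_{H-}(x, y)` without underestimators (`-∞` if infeasible). -/
def relaxHMinus (φ : (Fin d → ℝ) → ℝ)
    (W : Set ((Fin m → ℝ) × (Fin d → ℝ))) (x : Fin m → ℝ) (y : Fin d → ℝ) : EReal :=
  sSup (D.concQ φ '' D.feasHMinus W x y)

/-- The discretized relaxation `φ_H(x, y)` with underestimators (`-∞` if infeasible). -/
def relaxH (φ : (Fin d → ℝ) → ℝ) (u : (Fin m → ℝ) → Fin d → Fin (n + 1) → ℝ)
    (W : Set ((Fin m → ℝ) × (Fin d → ℝ))) (x : Fin m → ℝ) (y : Fin d → ℝ) : EReal :=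
  sSup (D.concQ φ '' D.feasH u W x y)

/-- The discrete function `ξ_{i,a_i}(·; w)`: its value at `a_{ij}` is `w_j`, and it is `-∞`
elsewhere (the supremum below has at most one term, since the `a_{ij}` are distinct). -/
def xi (i : Fin d) (w : Fin (n + 1) → EReal) (y : ℝ) : EReal :=
  ⨆ (j : Fin (n + 1)) (_ : D.a i j = y), w j

/-- The values `conc(ξ_{i,a_i})(a_{ij}; w_i)`, the envelope being taken over `[a_{i0}, a_{in}]`. -/
def envPoint (w : Fin d → Fin (n + 1) → EReal) (i : Fin d) (j : Fin (n + 1)) : EReal :=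
  conc (Set.Icc (D.a i 0) (D.a i (Fin.last n))) (D.xi i (w i)) (D.a i j)

/-- `ū_{ij} = f̄_i` for `j = n` and `ū_{ij} = u_{ij}(x̄)` for `j < n`, where `v = u(x̄)`. -/
def uBar (v : Fin d → Fin (n + 1) → ℝ) (fbar : Fin d → ℝ)
    (i : Fin d) (j : Fin (n + 1)) : EReal :=
  if j = Fin.last n then (fbar i : EReal) else (v i j : EReal)

/-- `û_{ij} = a_{ij}` for `j ≤ τ(i,t_i-1)`, `f̄_i` for `j ≥ τ(i,t_i)`, and `-∞` in between.
The index `t_i ∈ {1, …, l_i}` is encoded by `t i : Fin (l i)` with `t_i = t i + 1`. -/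
def uHat (t : (i : Fin d) → Fin (D.l i)) (fbar : Fin d → ℝ)
    (i : Fin d) (j : Fin (n + 1)) : EReal :=
  if j ≤ D.τ i (t i).castSucc then (D.a i j : EReal)
  else if D.τ i (t i).succ ≤ j then (fbar i : EReal)
  else ⊥

/-- `u* = ū ∨ û`, componentwise maximum. -/
def uStar (v : Fin d → Fin (n + 1) → ℝ) (t : (i : Fin d) → Fin (D.l i)) (fbar : Fin d → ℝ)
    (i : Fin d) (j : Fin (n + 1)) : EReal :=
  max (uBar v fbar i j) (D.uHat t fbar i j)

/-- The vector `v = u(x̄)` is a valid vector of underestimators at `(x̄, f̄)`: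
`u_{i0}(x̄) = a_{i0}` and `u_{ij}(x̄) ≤ min {a_{ij}, f̄_i}`. -/
def ValidAt (v : Fin d → Fin (n + 1) → ℝ) (fbar : Fin d → ℝ) : Prop :=
  ∀ i, v i 0 = D.a i 0 ∧ ∀ j, v i j ≤ min (D.a i j) (fbar i)

end DiscretizationScheme

end

/-! Each of the three problems maximizes `conc_Q(φ̄)` over the points of `Q` with prescribed last
coordinates that lie above some `w` (`ū`, `û` or `u*`). Two facts then give the value.

Monotonicity (`concQ_anti`): with last coordinates fixed, `conc_Q(φ̄)` decreases as `s` grows. If `s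
≤ s'` share last coordinates, some affine self-map `T` of `Q` preserves last coordinates and sends
`s'` to `s` (`exists_gridTransport_eq`, applied in each factor). For every concave majorant `g` of
`φ̄`, `g ∘ T` is again one, and its value at `s'` is `g s`.

Least element (`IsAdmissible.isLeast_above`): `Q_i` consists of the sequences concave over the grid
that start at `a_{i0}`, stay below `a_i` and attain their maximum at the last index. The envelope of
`w` is the least such sequence above `w`, so it is the optimal feasible point.

The discrete constraints fit this pattern because, when `f̄` lies in the selected box, (Inc) is
solvable in `δ` exactly when `s ≥ û` (`uHat_le_of_incremental`, `exists_incremental`). -/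

/-- The vertex `(a 0, …, a (j - 1), a j, …, a j)` attached to a grid `a`. -/
def gridVertex {n : ℕ} (a : Fin (n + 1) → ℝ) (j k : Fin (n + 1)) : ℝ := a (min k j)

/-- The convex hull of the vertices attached to a grid. -/
def gridSimplex {n : ℕ} (a : Fin (n + 1) → ℝ) : Set (Fin (n + 1) → ℝ) :=
  convexHull ℝ (Set.range (gridVertex a))

/-- Successive slopes of `s` over the grid `a`, preceded by `1`. -/
noncomputable def gridSlope {n : ℕ} (a s : Fin (n + 1) → ℝ) : Fin (n + 1) → ℝ :=
  Fin.cons 1 fun j : Fin n => (s j.succ - s j.castSucc) / (a j.succ - a j.castSucc)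

/-- Barycentric coordinates with respect to the vertices of the grid simplex. -/
noncomputable def gridWeight {n : ℕ} (a s : Fin (n + 1) → ℝ) (j : Fin (n + 1)) : ℝ :=
  gridSlope a s j -
    (Fin.snoc (α := fun _ => ℝ) (fun j : Fin n => gridSlope a s j.succ) 0 : Fin (n + 1) → ℝ) j

/-- Concavity of the finite sequence `c` over the grid `a`. -/
def GridConcave {n : ℕ} (a c : Fin (n + 1) → ℝ) : Prop :=
  ∀ j k l, j ≤ k → k ≤ l → c j * (a l - a k) + c l * (a k - a j) ≤ c k * (a l - a j)

/-! ### Grid simplices: barycentric coordinates, slopes and concave sequences. -/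

section Grid

variable {n : ℕ} {a s c : Fin (n + 1) → ℝ}

@[simp] theorem gridSlope_zero : gridSlope a s 0 = 1 := rfl

theorem gridSlope_succ (j : Fin n) :
    gridSlope a s j.succ = (s j.succ - s j.castSucc) / (a j.succ - a j.castSucc) := rfl

theorem gridWeight_castSucc (j : Fin n) :
    gridWeight a s j.castSucc = gridSlope a s j.castSucc - gridSlope a s j.succ := by
  simp [gridWeight]

theorem gridWeight_last : gridWeight a s (Fin.last n) = gridSlope a s (Fin.last n) := by
  simp [gridWeight]

/-- Abel summation: weights are consecutive differences of slopes. -/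
theorem sum_gridWeight_mul (x : Fin (n + 1) → ℝ) :
    ∑ j, gridWeight a s j * x j =
      x 0 + ∑ j : Fin n, gridSlope a s j.succ * (x j.succ - x j.castSucc) := by
  have h1 : ∑ j, gridSlope a s j * x j = x 0 + ∑ j : Fin n, gridSlope a s j.succ * x j.succ := by
    rw [Fin.sum_univ_succ]; simp
  have h2 : ∑ j, (Fin.snoc (α := fun _ => ℝ) (fun j : Fin n => gridSlope a s j.succ) 0 :
      Fin (n + 1) → ℝ) j * x j = ∑ j : Fin n, gridSlope a s j.succ * x j.castSucc := by
    rw [Fin.sum_univ_castSucc]; simp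
  simp only [gridWeight, sub_mul, Finset.sum_sub_distrib, mul_sub, h1, h2]
  ring

theorem sum_gridWeight : ∑ j, gridWeight a s j = 1 := by
  simpa using sum_gridWeight_mul (a := a) (s := s) fun _ => 1

theorem sum_ite_succ_le_sub (s : Fin (n + 1) → ℝ) (k : Fin (n + 1)) :
    ∑ j : Fin n, (if j.succ ≤ k then s j.succ - s j.castSucc else 0) = s k - s 0 := by
  induction k using Fin.induction with
  | zero => simp [Fin.succ_ne_zero]
  | succ i ih =>
    have h : ∀ j : Fin n, (if j.succ ≤ i.succ then s j.succ - s j.castSucc else 0) =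
        (if j.succ ≤ i.castSucc then s j.succ - s j.castSucc else 0) +
          if j = i then s j.succ - s j.castSucc else 0 := by
      intro j
      rcases lt_trichotomy j i with hj | rfl | hj
      · have h1 : j.succ ≤ i.succ := Fin.succ_le_succ_iff.2 hj.le
        have h2 : j.succ ≤ i.castSucc := by simpa [Fin.le_def] using hj
        simp [h1, h2, hj.ne]
      · simp
      · have h1 : ¬ j.succ ≤ i.succ := by simpa using hj
        have h2 : ¬ j.succ ≤ i.castSucc := by
          simp only [Fin.le_def, Fin.lt_def, Fin.val_succ, Fin.val_castSucc] at *; omega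
        simp [h1, h2, hj.ne']
    simp only [h, Finset.sum_add_distrib, ih, Finset.sum_ite_eq', Finset.mem_univ, if_true]
    ring

theorem sub_castSucc_pos (ha : StrictMono a) (j : Fin n) : 0 < a j.succ - a j.castSucc :=
  sub_pos.2 (ha Fin.castSucc_lt_succ)

theorem gridVertex_succ_sub (j : Fin n) (k : Fin (n + 1)) :
    gridVertex a j.succ k - gridVertex a j.castSucc k =
      if j.succ ≤ k then a j.succ - a j.castSucc else 0 := by
  unfold gridVertex
  split_ifs with h
  · rw [min_eq_right h, min_eq_right (Fin.castSucc_lt_succ.le.trans h)]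
  · have h2 : k ≤ j.castSucc := by
      simp only [Fin.le_def, Fin.val_succ, Fin.val_castSucc] at *; omega
    rw [min_eq_left h2, min_eq_left (not_le.1 h).le, sub_self]

/-- A sequence with the right initial value is the affine combination of the vertices given by
its barycentric coordinates. -/
theorem sum_gridWeight_mul_gridVertex (ha : StrictMono a) (h0 : s 0 = a 0) (k : Fin (n + 1)) :
    ∑ j, gridWeight a s j * gridVertex a j k = s k := by
  rw [sum_gridWeight_mul]
  have h : ∀ j : Fin n, gridSlope a s j.succ *
      (gridVertex a j.succ k - gridVertex a j.castSucc k) =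
      if j.succ ≤ k then s j.succ - s j.castSucc else 0 := by
    intro j
    rw [gridVertex_succ_sub, gridSlope_succ]
    split_ifs
    · exact div_mul_cancel₀ _ (sub_castSucc_pos ha j).ne'
    · simp
  simp only [h, sum_ite_succ_le_sub]
  simp [gridVertex, h0]

theorem gridWeight_nonneg (hz : Antitone (gridSlope a s)) (hl : 0 ≤ gridSlope a s (Fin.last n))
    (j : Fin (n + 1)) : 0 ≤ gridWeight a s j := by
  induction j using Fin.lastCases with
  | last => rwa [gridWeight_last]
  | cast j => rw [gridWeight_castSucc]; exact sub_nonneg.2 (hz Fin.castSucc_lt_succ.le)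

theorem gridSlope_sum {ι : Type*} (t : Finset ι) (μ : ι → ℝ) (w : ι → Fin (n + 1) → ℝ)
    (hμ : ∑ l ∈ t, μ l = 1) (j : Fin (n + 1)) :
    gridSlope a (fun k => ∑ l ∈ t, μ l * w l k) j = ∑ l ∈ t, μ l * gridSlope a (w l) j := by
  induction j using Fin.cases with
  | zero => simp [hμ]
  | succ j =>
    simp only [gridSlope_succ, ← Finset.sum_sub_distrib, Finset.sum_div]
    exact Finset.sum_congr rfl fun l _ => by ring

theorem gridWeight_sum {ι : Type*} (t : Finset ι) (μ : ι → ℝ) (w : ι → Fin (n + 1) → ℝ)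
    (hμ : ∑ l ∈ t, μ l = 1) (j : Fin (n + 1)) :
    gridWeight a (fun k => ∑ l ∈ t, μ l * w l k) j = ∑ l ∈ t, μ l * gridWeight a (w l) j := by
  induction j using Fin.lastCases with
  | last => simp only [gridWeight_last, gridSlope_sum t μ w hμ]
  | cast j =>
    simp only [gridWeight_castSucc, gridSlope_sum t μ w hμ, ← Finset.sum_sub_distrib, mul_sub]

theorem gridSlope_combo {x y : ℝ} (hxy : x + y = 1) (s s' : Fin (n + 1) → ℝ) (j : Fin (n + 1)) :
    gridSlope a (x • s + y • s') j = x * gridSlope a s j + y * gridSlope a s' j := by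
  induction j using Fin.cases with
  | zero => simp [hxy]
  | succ j => simp only [gridSlope_succ, Pi.add_apply, Pi.smul_apply, smul_eq_mul]; ring

theorem gridWeight_combo {x y : ℝ} (hxy : x + y = 1) (s s' : Fin (n + 1) → ℝ)
    (j : Fin (n + 1)) :
    gridWeight a (x • s + y • s') j = x * gridWeight a s j + y * gridWeight a s' j := by
  induction j using Fin.lastCases with
  | last => simp only [gridWeight_last, gridSlope_combo hxy]
  | cast j => simp only [gridWeight_castSucc, gridSlope_combo hxy]; ring

theorem gridVertex_mem (j : Fin (n + 1)) : gridVertex a j ∈ gridSimplex a :=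
  subset_convexHull ℝ _ ⟨j, rfl⟩

theorem gridSlope_gridVertex (ha : StrictMono a) (l j : Fin (n + 1)) :
    gridSlope a (gridVertex a l) j = if j ≤ l then 1 else 0 := by
  induction j using Fin.cases with
  | zero => simp
  | succ j =>
    rw [gridSlope_succ]
    unfold gridVertex
    split_ifs with h
    · rw [min_eq_left h, min_eq_left (Fin.castSucc_lt_succ.le.trans h),
        div_self (sub_castSucc_pos ha j).ne']
    · have h2 : l ≤ j.castSucc := by
        simp only [Fin.le_def, Fin.val_succ, Fin.val_castSucc] at *; omega
      rw [min_eq_right h2, min_eq_right (not_le.1 h).le, sub_self, zero_div]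

/-- The conditions are convex and hold at the vertices, whose slopes are ones followed by zeros.
Conversely, they say that the barycentric weights, being differences of consecutive slopes, are
nonnegative. -/
theorem mem_gridSimplex_iff (ha : StrictMono a) :
    s ∈ gridSimplex a ↔
      s 0 = a 0 ∧ Antitone (gridSlope a s) ∧ 0 ≤ gridSlope a s (Fin.last n) := by
  constructor
  · revert s
    suffices h : gridSimplex a ⊆
        {s | s 0 = a 0 ∧ Antitone (gridSlope a s) ∧ 0 ≤ gridSlope a s (Fin.last n)} from
      fun _ hs => h hs
    refine convexHull_min ?_ ?_
    · rintro _ ⟨l, rfl⟩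
      refine ⟨by simp [gridVertex], fun j k hjk => ?_, ?_⟩
      · rw [gridSlope_gridVertex ha, gridSlope_gridVertex ha]
        split_ifs with h1 h2
        · exact le_rfl
        · exact absurd (hjk.trans h1) h2
        · exact zero_le_one
        · exact le_rfl
      · rw [gridSlope_gridVertex ha]; split_ifs <;> simp
    · rintro p ⟨hp0, hp1, hp2⟩ q ⟨hq0, hq1, hq2⟩ x y hx hy hxy
      refine ⟨?_, fun j k hjk => ?_, ?_⟩
      · simp only [Pi.add_apply, Pi.smul_apply, smul_eq_mul, hp0, hq0, ← add_mul, hxy, one_mul]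
      · rw [gridSlope_combo hxy, gridSlope_combo hxy]
        exact add_le_add (mul_le_mul_of_nonneg_left (hp1 hjk) hx)
          (mul_le_mul_of_nonneg_left (hq1 hjk) hy)
      · rw [gridSlope_combo hxy]; positivity
  · rintro ⟨h0, h1, h2⟩
    have h : s = ∑ j, gridWeight a s j • gridVertex a j := by
      ext k
      simp [Finset.sum_apply, sum_gridWeight_mul_gridVertex ha h0]
    rw [h]
    exact (convex_convexHull ℝ _).sum_mem (fun j _ => gridWeight_nonneg h1 h2 j) sum_gridWeight
      fun j _ => gridVertex_mem j

/-- Serves twice: every vertex has this form, and this is the common upper bound for the envelopes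
of admissible `w`. -/
theorem gridConcave_min (ha : StrictMono a) (y : ℝ) : GridConcave a fun k => min (a k) y := by
  intro j k l hjk hkl
  have h1 := sub_nonneg.2 (ha.monotone hjk)
  have h2 := sub_nonneg.2 (ha.monotone hkl)
  rcases le_total (a k) y with h | h
  · have := mul_le_mul_of_nonneg_right (min_le_left (a j) y) h2
    have := mul_le_mul_of_nonneg_right (min_le_left (a l) y) h1
    simp only [min_eq_left h]
    nlinarith
  · have := mul_le_mul_of_nonneg_right (min_le_right (a j) y) h2
    have := mul_le_mul_of_nonneg_right (min_le_right (a l) y) h1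
    simp only [min_eq_right h]
    nlinarith

theorem gridConcave_of_mem (ha : StrictMono a) (hs : s ∈ gridSimplex a) : GridConcave a s := by
  suffices h : gridSimplex a ⊆ {s | GridConcave a s} from h hs
  refine convexHull_min ?_ ?_
  · rintro _ ⟨l, rfl⟩
    have h := gridConcave_min ha (a l)
    have h2 : gridVertex a l = fun k => min (a k) (a l) :=
      funext fun k => ha.monotone.map_min
    rw [Set.mem_ofPred_eq, h2]
    exact h
  · intro p hp q hq x y hx hy _ j k l hjk hkl
    have h1 := mul_le_mul_of_nonneg_left (hp j k l hjk hkl) hx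
    have h2 := mul_le_mul_of_nonneg_left (hq j k l hjk hkl) hy
    simp only [Pi.add_apply, Pi.smul_apply, smul_eq_mul]
    linarith

theorem monotone_of_mem (ha : StrictMono a) (hs : s ∈ gridSimplex a) : Monotone s := by
  obtain ⟨-, h1, h2⟩ := (mem_gridSimplex_iff ha).1 hs
  refine Fin.monotone_iff_le_succ.2 fun j => ?_
  have h : 0 ≤ gridSlope a s j.succ := h2.trans (h1 (Fin.le_last _))
  rw [gridSlope_succ, le_div_iff₀ (sub_castSucc_pos ha j)] at h
  linarith

theorem monotone_sub_of_mem (ha : StrictMono a) (hs : s ∈ gridSimplex a) :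
    Monotone fun k => a k - s k := by
  obtain ⟨-, h1, -⟩ := (mem_gridSimplex_iff ha).1 hs
  refine Fin.monotone_iff_le_succ.2 fun j => ?_
  have h : gridSlope a s j.succ ≤ 1 := h1 (Fin.zero_le _)
  rw [gridSlope_succ, div_le_one (sub_castSucc_pos ha j)] at h
  linarith

theorem le_of_mem (ha : StrictMono a) (hs : s ∈ gridSimplex a) (k : Fin (n + 1)) : s k ≤ a k := by
  have h := monotone_sub_of_mem ha hs (Fin.zero_le k)
  have h0 := ((mem_gridSimplex_iff ha).1 hs).1
  simp only [h0] at h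
  linarith

/-- Concavity makes the slopes decrease, so only the bounds 1 and 0 at the two ends remain; they
come from `c ≤ a` and from the maximum at the last index. -/
theorem GridConcave.mem_gridSimplex (ha : StrictMono a) (hc : GridConcave a c) (h0 : c 0 = a 0)
    (hca : ∀ k, c k ≤ a k) (hcl : ∀ k, c k ≤ c (Fin.last n)) : c ∈ gridSimplex a := by
  have hone : ∀ j, gridSlope a c j ≤ 1 := by
    intro j
    induction j using Fin.cases with
    | zero => simp
    | succ j =>
      have hd := sub_castSucc_pos ha j
      rw [gridSlope_succ, div_le_one hd]
      -- The slope of the last step is at most the mean slope from index 0, which is at most 1 since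
      -- `c 0 = a 0` and `c ≤ a`.
      have h1 := hc 0 j.castSucc j.succ (Fin.zero_le _) Fin.castSucc_lt_succ.le
      have h2 : 0 < a j.succ - a 0 := sub_pos.2 (ha (Fin.succ_pos j))
      have h3 := mul_nonneg hd.le (sub_nonneg.2 (hca j.succ))
      rw [h0] at h1
      by_contra! h
      have := mul_lt_mul_of_pos_right h h2
      nlinarith
  refine (mem_gridSimplex_iff ha).2 ⟨h0, fun j k hjk => ?_, ?_⟩
  · induction j using Fin.cases with
    | zero => simpa using hone k
    | succ j =>
      induction k using Fin.cases with
      | zero => simp [Fin.succ_ne_zero] at hjk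
      | succ k =>
        rcases (Fin.succ_le_succ_iff.1 hjk).eq_or_lt with rfl | hlt
        · exact le_rfl
        have hj := sub_castSucc_pos ha j
        have hk := sub_castSucc_pos ha k
        have hjk' : j.succ ≤ k.castSucc := by simpa [Fin.le_def] using hlt
        have h1 := hc j.castSucc j.succ k.succ Fin.castSucc_lt_succ.le hjk
        have h2 := hc j.succ k.castSucc k.succ hjk' Fin.castSucc_lt_succ.le
        have hm : 0 < a k.succ - a j.succ := sub_pos.2 (ha (by simpa using hlt))
        rw [gridSlope_succ, gridSlope_succ]
        -- The two slopes are compared through the chord joining the right ends of both steps.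
        trans (c k.succ - c j.succ) / (a k.succ - a j.succ)
        · rw [div_le_div_iff₀ hk hm]; linarith
        · rw [div_le_div_iff₀ hm hj]; linarith
  -- A free index permits the case split; its zero case is `n = 0`, where the slope is 1 by
  -- convention.
  · have : ∀ k, k = Fin.last n → 0 ≤ gridSlope a c k := by
      intro k
      induction k using Fin.cases with
      | zero => simp
      | succ j =>
        intro h
        rw [gridSlope_succ, h]
        refine div_nonneg (sub_nonneg.2 (hcl _)) ?_
        rw [← h]
        exact (sub_castSucc_pos ha j).le
    exact this _ rfl

/-- A concave sequence has a supporting line at every grid point. -/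
theorem GridConcave.exists_supporting_line (ha : StrictMono a) (hc : GridConcave a c)
    (h0 : c 0 = a 0) (hca : ∀ k, c k ≤ a k) (k : Fin (n + 1)) :
    ∃ m : ℝ, ∀ l, c l ≤ c k + m * (a l - a k) := by
  induction k using Fin.cases with
  | zero => exact ⟨1, fun l => by linarith [hca l]⟩
  | succ k =>
    have hd := sub_castSucc_pos ha k
    refine ⟨(c k.succ - c k.castSucc) / (a k.succ - a k.castSucc), fun l => ?_⟩
    rw [div_mul_eq_mul_div, ← sub_le_iff_le_add', le_div_iff₀ hd]
    rcases le_or_gt k.succ l with h | h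
    · have := hc k.castSucc k.succ l Fin.castSucc_lt_succ.le h
      linarith
    · have h' : l ≤ k.castSucc := by
        simp only [Fin.le_def, Fin.lt_def, Fin.val_succ, Fin.val_castSucc] at *; omega
      have := hc l k.castSucc k.succ h' Fin.castSucc_lt_succ.le
      linarith

end Grid

/-- The affine self-map of the grid simplex that sends the `j`-th vertex to `w j`. -/
noncomputable def gridTransport {n : ℕ} (a : Fin (n + 1) → ℝ) (w : Fin (n + 1) → Fin (n + 1) → ℝ)
    (s : Fin (n + 1) → ℝ) : Fin (n + 1) → ℝ :=
  fun k => ∑ j, gridWeight a s j * w j k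

/-- Images of the vertices under the affine self-maps of the grid simplex that preserve the last
coordinate. -/
def gridKernels {n : ℕ} (a : Fin (n + 1) → ℝ) : Set (Fin (n + 1) → Fin (n + 1) → ℝ) :=
  {w | ∀ j, w j ∈ gridSimplex a ∧ w j (Fin.last n) = a j}

/-! ### Affine self-maps of a grid simplex that fix the last coordinate. -/

section Transport

variable {n : ℕ} {a s s' : Fin (n + 1) → ℝ} {w w' : Fin (n + 1) → Fin (n + 1) → ℝ}

theorem gridVertex_last (j : Fin (n + 1)) : gridVertex a j (Fin.last n) = a j := by
  simp [gridVertex, min_eq_right (Fin.le_last j)]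

theorem gridVertex_mem_gridKernels : gridVertex a ∈ gridKernels a :=
  fun j => ⟨gridVertex_mem j, gridVertex_last j⟩

theorem gridTransport_gridVertex (ha : StrictMono a) (hs : s ∈ gridSimplex a) :
    gridTransport a (gridVertex a) s = s :=
  funext fun k => sum_gridWeight_mul_gridVertex ha ((mem_gridSimplex_iff ha).1 hs).1 k

theorem gridWeight_nonneg_of_mem (ha : StrictMono a) (hs : s ∈ gridSimplex a) (j : Fin (n + 1)) :
    0 ≤ gridWeight a s j :=
  gridWeight_nonneg ((mem_gridSimplex_iff ha).1 hs).2.1 ((mem_gridSimplex_iff ha).1 hs).2.2 j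

theorem gridTransport_mem (ha : StrictMono a) (hw : w ∈ gridKernels a) (hs : s ∈ gridSimplex a) :
    gridTransport a w s ∈ gridSimplex a := by
  have h : gridTransport a w s = ∑ j, gridWeight a s j • w j := by
    ext k
    simp [gridTransport, Finset.sum_apply]
  rw [h]
  exact (convex_convexHull ℝ _).sum_mem (fun j _ => gridWeight_nonneg_of_mem ha hs j)
    sum_gridWeight fun j _ => (hw j).1

theorem gridTransport_last (ha : StrictMono a) (hw : w ∈ gridKernels a) (hs : s ∈ gridSimplex a) :
    gridTransport a w s (Fin.last n) = s (Fin.last n) := by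
  rw [← sum_gridWeight_mul_gridVertex ha ((mem_gridSimplex_iff ha).1 hs).1]
  exact Finset.sum_congr rfl fun j _ => by rw [(hw j).2, gridVertex_last]

theorem gridTransport_combo {x y : ℝ} (hxy : x + y = 1) (s s' : Fin (n + 1) → ℝ) :
    gridTransport a w (x • s + y • s') = x • gridTransport a w s + y • gridTransport a w s' := by
  ext k
  simp only [gridTransport, gridWeight_combo hxy, Pi.add_apply, Pi.smul_apply, smul_eq_mul,
    Finset.mul_sum, ← Finset.sum_add_distrib]
  exact Finset.sum_congr rfl fun j _ => by ring

/-- Closure under composition: a transport can be followed by a lowering step and remain in the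
family over which one minimizes. -/
theorem gridTransport_gridTransport :
    gridTransport a w' (gridTransport a w s) =
      gridTransport a (fun j => gridTransport a w' (w j)) s := by
  ext k
  simp only [gridTransport, Finset.mul_sum]
  rw [Finset.sum_comm]
  refine Finset.sum_congr rfl fun j _ => ?_
  change gridWeight a (fun k => ∑ l, gridWeight a s l * w l k) j * _ = _
  rw [gridWeight_sum _ _ _ sum_gridWeight, Finset.sum_mul]
  exact Finset.sum_congr rfl fun l _ => by ring

theorem gridTransport_mem_gridKernels (ha : StrictMono a) (hw : w ∈ gridKernels a)
    (hw' : w' ∈ gridKernels a) : (fun j => gridTransport a w' (w j)) ∈ gridKernels a :=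
  fun j => ⟨gridTransport_mem ha hw' (hw j).1,
    (gridTransport_last ha hw' (hw j).1).trans (hw j).2⟩

/-- Two points of the simplex with the same last coordinate, one above the other, agree or the
upper one has a kink where it is strictly above. -/
theorem exists_kink (ha : StrictMono a) (hs : s ∈ gridSimplex a) (hs' : s' ∈ gridSimplex a)
    (hle : s ≤ s') (hlast : s (Fin.last n) = s' (Fin.last n)) (hne : s' ≠ s) :
    ∃ k, s k < s' k ∧ 0 < gridWeight a s' k := by
  by_contra! hno
  obtain ⟨h0, hz, -⟩ := (mem_gridSimplex_iff ha).1 hs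
  have h0' := ((mem_gridSimplex_iff ha).1 hs').1
  -- Without such a kink, once `s'` rises above `s` its slope cannot drop while that of `s` cannot
  -- increase, so the gap persists up to the last index, where it must vanish.
  have key : ∀ j, (∀ i ≤ j, s' i = s i) ∨ (s j < s' j ∧ gridSlope a s j < gridSlope a s' j) := by
    intro j
    induction j using Fin.induction with
    | zero =>
      refine Or.inl fun i hi => ?_
      rw [Fin.le_zero_iff.1 hi, h0, h0']
    | succ j ih =>
      have hd := sub_castSucc_pos ha j
      rcases ih with ih | ⟨ih1, ih2⟩
      · rcases (hle j.succ).eq_or_lt with h | h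
        · refine Or.inl fun i hi => ?_
          rcases hi.eq_or_lt with rfl | hi
          · exact h.symm
          · exact ih i (by simp only [Fin.le_def, Fin.lt_def, Fin.val_succ, Fin.val_castSucc] at *
                           omega)
        · refine Or.inr ⟨h, ?_⟩
          rw [gridSlope_succ, gridSlope_succ, ih _ le_rfl]
          exact div_lt_div_of_pos_right (by linarith) hd
      · have h1 := hno _ ih1
        rw [gridWeight_castSucc] at h1
        have h2 : gridSlope a s j.succ ≤ gridSlope a s j.castSucc := hz Fin.castSucc_lt_succ.le
        have h3 : gridSlope a s j.succ < gridSlope a s' j.succ := by linarith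
        refine Or.inr ⟨?_, h3⟩
        rw [gridSlope_succ, gridSlope_succ, div_lt_div_iff_of_pos_right hd] at h3
        linarith
  rcases key (Fin.last n) with h | h
  · exact hne (funext fun i => h i (Fin.le_last i))
  · exact h.1.ne hlast

/-- At an interior grid point, the vertex can be lowered in the single coordinate `k` by moving
to a convex combination of its two neighbours. -/
theorem exists_lowered_vertex (ha : StrictMono a) {k : Fin (n + 1)} (hk0 : k ≠ 0)
    (hkn : k ≠ Fin.last n) :
    ∃ q ∈ gridSimplex a, ∃ η > 0, ∀ j, q j = gridVertex a k j - if j = k then η else 0 := by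
  obtain ⟨p, rfl⟩ := Fin.exists_succ_eq.2 hk0
  obtain ⟨r, hr⟩ := Fin.exists_castSucc_eq.2 hkn
  have hrv : (r : ℕ) = p + 1 := by simpa using congrArg Fin.val hr
  have h1 := sub_castSucc_pos ha p
  have h2 : 0 < a r.succ - a p.succ := by simpa [hr] using sub_castSucc_pos ha r
  have h3 : 0 < a r.succ - a p.castSucc := by linarith
  -- Weights expressing the grid value at `k` as a mean of its neighbours; the mixture of the
  -- neighbouring vertices then agrees with vertex `k` except in coordinate `k`.
  set α := (a r.succ - a p.succ) / (a r.succ - a p.castSucc) with hα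
  set β := (a p.succ - a p.castSucc) / (a r.succ - a p.castSucc) with hβ
  have hαβ : α + β = 1 := by rw [hα, hβ, ← add_div, div_eq_one_iff_eq h3.ne']; ring
  have hmean : α * a p.castSucc + β * a r.succ = a p.succ := by
    rw [hα, hβ]; field_simp; ring
  have hα0 : 0 < α := div_pos h2 h3
  have hβ0 : 0 < β := div_pos h1 h3
  refine ⟨α • gridVertex a p.castSucc + β • gridVertex a r.succ,
    (convex_convexHull ℝ _) (gridVertex_mem _) (gridVertex_mem _) hα0.le hβ0.le hαβ,
    α * (a p.succ - a p.castSucc), mul_pos hα0 h1, fun j => ?_⟩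
  simp only [Pi.add_apply, Pi.smul_apply, smul_eq_mul, gridVertex]
  rcases lt_trichotomy j p.succ with h | rfl | h
  · have e1 : j ≤ p.castSucc := by
      simp only [Fin.le_def, Fin.lt_def, Fin.val_succ, Fin.val_castSucc] at *; omega
    have e2 : j ≤ r.succ := by
      simp only [Fin.le_def, Fin.lt_def, Fin.val_succ, Fin.val_castSucc] at *; omega
    rw [min_eq_left e1, min_eq_left e2, min_eq_left h.le, if_neg h.ne, ← add_mul, hαβ]
    ring
  · have e2 : p.succ ≤ r.succ := by
      simp only [Fin.le_def, Fin.val_succ]; omega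
    rw [min_eq_right Fin.castSucc_lt_succ.le, min_eq_left e2, min_self, if_pos rfl]
    linear_combination (a p.succ) * hαβ
  · have e1 : p.castSucc ≤ j := Fin.castSucc_lt_succ.le.trans h.le
    have e2 : r.succ ≤ j := by
      simp only [Fin.le_def, Fin.lt_def, Fin.val_succ] at *; omega
    rw [min_eq_right e1, min_eq_right e2, min_eq_right h.le, if_neg h.ne', hmean, sub_zero]

/-- A point of the simplex with a kink strictly above `s` can be lowered by a transport while
staying above `s`. -/
theorem exists_gridTransport_lt (ha : StrictMono a) (hs : s ∈ gridSimplex a)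
    (hs' : s' ∈ gridSimplex a) (hle : s ≤ s') (hlast : s (Fin.last n) = s' (Fin.last n))
    (hne : s' ≠ s) :
    ∃ w ∈ gridKernels a, s ≤ gridTransport a w s' ∧ gridTransport a w s' < s' := by
  obtain ⟨k, hk, hμ⟩ := exists_kink ha hs hs' hle hlast hne
  have hk0 : k ≠ 0 := by
    rintro rfl
    rw [((mem_gridSimplex_iff ha).1 hs).1, ((mem_gridSimplex_iff ha).1 hs').1] at hk
    exact hk.false
  have hkn : k ≠ Fin.last n := by
    rintro rfl
    exact hk.ne hlast
  obtain ⟨q, hq, η, hη, hqj⟩ := exists_lowered_vertex ha hk0 hkn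
  set μ := gridWeight a s' k with hμdef
  -- Moving vertex `k` by the fraction `θ` lowers `s' k` by `θ * (μ * η)`; the cap keeps the result
  -- above `s`.
  set θ := min 1 ((s' k - s k) / (μ * η)) with hθ
  have hθ0 : 0 < θ := lt_min one_pos (div_pos (sub_pos.2 hk) (mul_pos hμ hη))
  have hθ1 : θ ≤ 1 := min_le_left _ _
  have hθ2 : θ * (μ * η) ≤ s' k - s k := (le_div_iff₀ (mul_pos hμ hη)).1 (min_le_right _ _)
  set w := Function.update (gridVertex a) k ((1 - θ) • gridVertex a k + θ • q) with hw
  have hwk : w ∈ gridKernels a := by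
    intro j
    rcases eq_or_ne j k with rfl | hj
    · rw [hw, Function.update_self]
      refine ⟨(convex_convexHull ℝ _) (gridVertex_mem _) hq (by linarith) hθ0.le (by ring), ?_⟩
      simp only [Pi.add_apply, Pi.smul_apply, smul_eq_mul, hqj, if_neg hkn.symm, gridVertex_last]
      ring
    · rw [hw, Function.update_of_ne hj]
      exact gridVertex_mem_gridKernels j
  have hT : ∀ j, gridTransport a w s' j = s' j - if j = k then θ * (μ * η) else 0 := by
    intro j
    have h1 : ∀ l, gridWeight a s' l * w l j = gridWeight a s' l * gridVertex a l j -
        if l = k then (if j = k then θ * (μ * η) else 0) else 0 := by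
      intro l
      rcases eq_or_ne l k with rfl | hl
      · simp only [hw, Function.update_self, Pi.add_apply, Pi.smul_apply, smul_eq_mul, hqj,
          if_true]
        split_ifs <;> ring
      · rw [hw, Function.update_of_ne hl, if_neg hl, sub_zero]
    simp only [gridTransport, h1, Finset.sum_sub_distrib, Finset.sum_ite_eq', Finset.mem_univ,
      if_true]
    rw [sum_gridWeight_mul_gridVertex ha ((mem_gridSimplex_iff ha).1 hs').1]
  have hpos : 0 < θ * (μ * η) := mul_pos hθ0 (mul_pos hμ hη)
  refine ⟨w, hwk, fun j => ?_, Pi.lt_def.2 ⟨fun j => ?_, k, ?_⟩⟩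
  · rw [hT]
    split_ifs with h
    · subst h; linarith
    · simpa using hle j
  · rw [hT]
    split_ifs <;> linarith
  · rw [hT, if_pos rfl]
    linarith

theorem isCompact_gridKernels (a : Fin (n + 1) → ℝ) : IsCompact (gridKernels a) := by
  have h : gridKernels a = Set.pi Set.univ fun j =>
      gridSimplex a ∩ {x | x (Fin.last n) = a j} := by
    ext w
    simp [gridKernels, Set.mem_pi]
  rw [h]
  refine isCompact_univ_pi fun j => ?_
  exact ((Set.finite_range _).isCompact_convexHull ℝ).inter_right
    (isClosed_eq (continuous_apply _) continuous_const)

/-- If `s ≤ s'` in the grid simplex have the same last coordinate, then an affine self-map of the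
simplex preserving the last coordinate sends `s'` to `s`. -/
theorem exists_gridTransport_eq (ha : StrictMono a) (hs : s ∈ gridSimplex a)
    (hs' : s' ∈ gridSimplex a) (hle : s ≤ s') (hlast : s (Fin.last n) = s' (Fin.last n)) :
    ∃ w ∈ gridKernels a, gridTransport a w s' = s := by
  have hcont : Continuous fun w => gridTransport a w s' := by
    unfold gridTransport
    fun_prop
  obtain ⟨w, ⟨hwK, hws⟩, hmin⟩ := ((isCompact_gridKernels a).inter_right
    (isClosed_le continuous_const hcont : IsClosed {w | s ≤ gridTransport a w s'})).exists_isMinOn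
    ⟨gridVertex a, gridVertex_mem_gridKernels,
      show s ≤ gridTransport a (gridVertex a) s' by rwa [gridTransport_gridVertex ha hs']⟩
    -- Among transports keeping `s'` above `s`, one minimizing the coordinate sum must reach `s`,
    -- since otherwise a further lowering reduces the sum.
    (f := fun w => ∑ k, gridTransport a w s' k)
    (by fun_prop : Continuous _).continuousOn
  refine ⟨w, hwK, ?_⟩
  by_contra hne
  obtain ⟨w', hw', h1, h2⟩ := exists_gridTransport_lt ha hs (gridTransport_mem ha hwK hs') hws
    (hlast.trans (gridTransport_last ha hwK hs').symm) hne
  rw [gridTransport_gridTransport] at h1 h2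
  have h3 := hmin ⟨gridTransport_mem_gridKernels ha hwK hw', h1⟩
  obtain ⟨h4, k, h5⟩ := Pi.lt_def.1 h2
  exact absurd h3 (not_le.2 (Finset.sum_lt_sum (fun k _ => h4 k) ⟨k, Finset.mem_univ _, h5⟩))

end Transport

/-! ### Antitonicity of `conc_Q(φ̄)` for fixed last coordinates. -/

namespace DiscretizationScheme

variable {d n : ℕ} (D : DiscretizationScheme d n)

theorem mem_Q_iff {s : Fin d → Fin (n + 1) → ℝ} : s ∈ D.Q ↔ ∀ i, s i ∈ gridSimplex (D.a i) :=
  Iff.rfl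

/-- The envelope `conc_Q(φ̄)` is antitone once the last coordinates are fixed. -/
theorem concQ_anti (φ : (Fin d → ℝ) → ℝ) {s s' : Fin d → Fin (n + 1) → ℝ} (hs : s ∈ D.Q)
    (hs' : s' ∈ D.Q) (hle : s ≤ s') (hlast : ∀ i, s i (Fin.last n) = s' i (Fin.last n)) :
    D.concQ φ s' ≤ D.concQ φ s := by
  choose w hw hws using fun i =>
    exists_gridTransport_eq (D.a_strictMono i) (hs i) (hs' i) (hle i) (hlast i)
  set T : (Fin d → Fin (n + 1) → ℝ) → Fin d → Fin (n + 1) → ℝ :=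
    fun p i => gridTransport (D.a i) (w i) (p i) with hT
  have hTQ : ∀ p ∈ D.Q, T p ∈ D.Q := fun p hp i =>
    gridTransport_mem (D.a_strictMono i) (hw i) (hp i)
  have hTs : T s' = s := funext hws
  refine le_sInf ?_
  rintro _ ⟨g, hg, hφ, rfl⟩
  refine sInf_le ⟨fun p => g (T p), ?_, fun p hp => ?_, by simp only [hTs]⟩
  · rintro ⟨p, r⟩ ⟨hp, hr⟩ ⟨p', r'⟩ ⟨hp', hr'⟩ x y hx hy hxy
    have h := hg (x := (T p, r)) ⟨hTQ p hp, hr⟩ (y := (T p', r')) ⟨hTQ p' hp', hr'⟩ hx hy hxy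
    refine ⟨fun i => (convex_convexHull ℝ _) (hp i) (hp' i) hx hy hxy, ?_⟩
    have hc : T (x • p + y • p') = x • T p + y • T p' :=
      funext fun i => gridTransport_combo hxy (p i) (p' i)
    simpa [hc] using h.2
  · refine le_of_eq_of_le ?_ (hφ (T p) (hTQ p hp))
    exact congrArg (fun v => ((φ v : ℝ) : EReal)) (funext fun i =>
      (gridTransport_last (D.a_strictMono i) (hw i) (hp i)).symm)

end DiscretizationScheme

/-! ### Concave envelopes of extended-real functions. -/

section Envelope

variable {E : Type*} [AddCommGroup E] [Module ℝ E] {S : Set E} {f : E → EReal}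

theorem eConcaveOn_conc (hS : Convex ℝ S) : EConcaveOn S (conc S f) := by
  rintro p ⟨hp, hpr⟩ q ⟨hq, hqr⟩ x y hx hy hxy
  refine ⟨hS hp hq hx hy hxy, le_sInf ?_⟩
  rintro _ ⟨g, hg, hfg, rfl⟩
  exact (hg ⟨hp, hpr.trans (sInf_le ⟨g, hg, hfg, rfl⟩)⟩
    ⟨hq, hqr.trans (sInf_le ⟨g, hg, hfg, rfl⟩)⟩ hx hy hxy).2

theorem le_conc {x : E} (hx : x ∈ S) : f x ≤ conc S f x := by
  refine le_sInf ?_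
  rintro _ ⟨g, -, hfg, rfl⟩
  exact hfg x hx

theorem conc_le {g : E → EReal} (hg : EConcaveOn S g) (hfg : ∀ y ∈ S, f y ≤ g y) (x : E) :
    conc S f x ≤ g x :=
  sInf_le ⟨g, hg, hfg, rfl⟩

theorem eConcaveOn_line {S : Set ℝ} (hS : Convex ℝ S) (c m b : ℝ) :
    EConcaveOn S fun y => ((c + m * (y - b) : ℝ) : EReal) := by
  rintro ⟨p, r⟩ ⟨hp, hr⟩ ⟨q, r'⟩ ⟨hq, hr'⟩ x y hx hy hxy
  refine ⟨hS hp hq hx hy hxy, ?_⟩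
  have h1 := mul_le_mul_of_nonneg_left (EReal.coe_le_coe_iff.1 hr) hx
  have h2 := mul_le_mul_of_nonneg_left (EReal.coe_le_coe_iff.1 hr') hy
  refine EReal.coe_le_coe_iff.2 ?_
  simp only [Prod.fst_add, Prod.snd_add, Prod.smul_fst, Prod.smul_snd, smul_eq_mul]
  obtain rfl : y = 1 - x := by linarith
  linarith

end Envelope

/-! ### Slopes saturated at 1 or at 0. -/

section Slope

variable {n : ℕ} {a s : Fin (n + 1) → ℝ}

/-- Slopes decrease, so all those up to `k` are at least 1; summing the increments from index 0
gives the bound. -/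
theorem le_of_one_le_gridSlope (ha : StrictMono a) (hs : s ∈ gridSimplex a) {k : Fin (n + 1)}
    (hk : 1 ≤ gridSlope a s k) : a k ≤ s k := by
  obtain ⟨h0, hz, -⟩ := (mem_gridSimplex_iff ha).1 hs
  have h : a k - a 0 ≤ s k - s 0 := by
    rw [← sum_ite_succ_le_sub, ← sum_ite_succ_le_sub]
    refine Finset.sum_le_sum fun j _ => ?_
    split_ifs with hj
    · have h1 := hk.trans (hz hj)
      rwa [gridSlope_succ, one_le_div (sub_castSucc_pos ha j)] at h1
    · exact le_rfl
  linarith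

theorem one_le_gridSlope (ha : StrictMono a) (hs : s ∈ gridSimplex a) {k : Fin (n + 1)}
    (hk : a k ≤ s k) : 1 ≤ gridSlope a s k := by
  induction k using Fin.cases with
  | zero => simp
  | succ j =>
    rw [gridSlope_succ, one_le_div (sub_castSucc_pos ha j)]
    linarith [le_of_mem ha hs j.castSucc]

theorem last_le_of_gridSlope_nonpos (ha : StrictMono a) {k : Fin (n + 1)}
    (hk : ∀ j, k < j → gridSlope a s j ≤ 0) : s (Fin.last n) ≤ s k := by
  have h : ∀ j, k ≤ j → s j ≤ s k := by
    intro j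
    induction j using Fin.induction with
    | zero => intro h; rw [Fin.le_zero_iff.1 h]
    | succ j ih =>
      intro h
      rcases h.eq_or_lt with rfl | h
      · exact le_rfl
      · have h1 := hk _ h
        rw [gridSlope_succ, div_le_iff₀ (sub_castSucc_pos ha j)] at h1
        have h2 := ih (by
          simp only [Fin.le_def, Fin.lt_def, Fin.val_succ, Fin.val_castSucc] at *; omega)
        linarith
  exact h _ (Fin.le_last k)

theorem gridSlope_nonpos (ha : StrictMono a) (hs : s ∈ gridSimplex a) {k j : Fin (n + 1)}
    (hk : s (Fin.last n) ≤ s k) (hj : k < j) : gridSlope a s j ≤ 0 := by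
  induction j using Fin.cases with
  | zero => simp at hj
  | succ j =>
    rw [gridSlope_succ, div_le_iff₀ (sub_castSucc_pos ha j), zero_mul, sub_nonpos]
    exact (monotone_of_mem ha hs (Fin.le_last _)).trans (hk.trans (monotone_of_mem ha hs (by
      simp only [Fin.le_def, Fin.lt_def, Fin.val_succ, Fin.val_castSucc] at *; omega)))

end Slope

/-! ### Envelopes of discrete functions as least elements of `Q`. -/

namespace DiscretizationScheme

variable {d n : ℕ} (D : DiscretizationScheme d n)

theorem xi_grid (i : Fin d) (w : Fin (n + 1) → EReal) (j : Fin (n + 1)) :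
    D.xi i w (D.a i j) = w j := by
  simp [xi, (D.a_strictMono i).injective.eq_iff]

theorem xi_le {i : Fin d} {w : Fin (n + 1) → EReal} {g : ℝ → EReal}
    (h : ∀ j, w j ≤ g (D.a i j)) (y : ℝ) : D.xi i w y ≤ g y :=
  iSup₂_le fun j hj => hj ▸ h j

theorem a_mem_Icc (i : Fin d) (j : Fin (n + 1)) :
    D.a i j ∈ Set.Icc (D.a i 0) (D.a i (Fin.last n)) :=
  ⟨(D.a_strictMono i).monotone (Fin.zero_le j), (D.a_strictMono i).monotone (Fin.le_last j)⟩

variable {D} {w : Fin d → Fin (n + 1) → EReal} {i : Fin d}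

theorem le_envPoint (j : Fin (n + 1)) : w i j ≤ D.envPoint w i j := by
  have h := le_conc (f := D.xi i (w i)) (D.a_mem_Icc i j)
  rwa [xi_grid] at h

theorem envPoint_le_line {c e b : ℝ} (h : ∀ l, w i l ≤ ((c + e * (D.a i l - b) : ℝ) : EReal))
    (j : Fin (n + 1)) : D.envPoint w i j ≤ ((c + e * (D.a i j - b) : ℝ) : EReal) :=
  conc_le (eConcaveOn_line (convex_Icc _ _) c e b)
    (fun y _ => D.xi_le (g := fun y => ((c + e * (y - b) : ℝ) : EReal)) h y) _

/-- Only the value at one grid point matters, so the supporting line of `c` there is a sufficient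
concave majorant and `c` need not be interpolated. -/
theorem envPoint_le {c : Fin (n + 1) → ℝ} (hc : GridConcave (D.a i) c) (h0 : c 0 = D.a i 0)
    (hca : ∀ k, c k ≤ D.a i k) (hwc : ∀ k, w i k ≤ c k) (j : Fin (n + 1)) :
    D.envPoint w i j ≤ c j := by
  obtain ⟨e, he⟩ := hc.exists_supporting_line (D.a_strictMono i) h0 hca j
  have h := envPoint_le_line (D := D) (w := w) (i := i) (c := c j) (e := e) (b := D.a i j)
    (fun l => (hwc l).trans (EReal.coe_le_coe_iff.2 (he l))) j
  simpa using h

theorem envPoint_combo {j k l : Fin (n + 1)} {x y r r' : ℝ} (hx : 0 ≤ x) (hy : 0 ≤ y)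
    (hxy : x + y = 1) (hk : x * D.a i j + y * D.a i l = D.a i k)
    (hr : (r : EReal) ≤ D.envPoint w i j) (hr' : (r' : EReal) ≤ D.envPoint w i l) :
    ((x * r + y * r' : ℝ) : EReal) ≤ D.envPoint w i k := by
  have h := (eConcaveOn_conc (f := D.xi i (w i))
    (convex_Icc (D.a i 0) (D.a i (Fin.last n))) (x := (D.a i j, r)) ⟨D.a_mem_Icc i j, hr⟩
    (y := (D.a i l, r')) ⟨D.a_mem_Icc i l, hr'⟩ hx hy hxy).2
  simpa only [envPoint, Prod.fst_add, Prod.snd_add, Prod.smul_fst, Prod.smul_snd, smul_eq_mul,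
    hk] using h

theorem exists_real_envPoint (h0 : w i 0 ≠ ⊥) (hl : w i (Fin.last n) ≠ ⊥) (ht : ∀ j, w i j ≠ ⊤)
    (j : Fin (n + 1)) : ∃ r : ℝ, (r : EReal) = D.envPoint w i j := by
  refine ⟨(D.envPoint w i j).toReal, EReal.coe_toReal ?_ ?_⟩
  -- A constant majorant bounds the envelope above; `toReal` turns `⊥` into 0, which is harmless
  -- here.
  · obtain ⟨M, hM⟩ := (Set.finite_range fun l => (w i l).toReal).bddAbove
    have h := envPoint_le_line (D := D) (w := w) (i := i) (c := M) (e := 0) (b := 0)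
      (fun l => (EReal.le_coe_toReal (ht l)).trans
        (EReal.coe_le_coe_iff.2 (by simpa using hM ⟨l, rfl⟩))) j
    exact (h.trans_lt (EReal.coe_lt_top _)).ne
  -- The chord between the two finite end values bounds the envelope below.
  · have hj := D.a_mem_Icc i j
    rw [← segment_eq_Icc (hj.1.trans hj.2)] at hj
    obtain ⟨x, y, hx, hy, hxy, hk⟩ := hj
    have h := envPoint_combo (D := D) (w := w) hx hy hxy hk
      ((EReal.coe_toReal_le h0).trans (le_envPoint _))
      ((EReal.coe_toReal_le hl).trans (le_envPoint _))
    exact ((EReal.bot_lt_coe _).trans_le h).ne'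

theorem gridConcave_envPoint {c : Fin (n + 1) → ℝ}
    (hc : ∀ j, (c j : EReal) = D.envPoint w i j) : GridConcave (D.a i) c := by
  intro j k l hjk hkl
  have h1 := sub_nonneg.2 ((D.a_strictMono i).monotone hjk)
  have h2 := sub_nonneg.2 ((D.a_strictMono i).monotone hkl)
  rcases (hjk.trans hkl).eq_or_lt with rfl | hjl
  · obtain rfl := le_antisymm hjk hkl
    simp
  have h3 : 0 < D.a i l - D.a i j := sub_pos.2 (D.a_strictMono i hjl)
  have h := envPoint_combo (D := D) (w := w) (i := i) (j := j) (k := k) (l := l)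
    (x := (D.a i l - D.a i k) / (D.a i l - D.a i j))
    (y := (D.a i k - D.a i j) / (D.a i l - D.a i j)) (div_nonneg h2 h3.le) (div_nonneg h1 h3.le)
    (by rw [← add_div, div_eq_one_iff_eq h3.ne']; ring) (by field_simp; ring) (hc j).le (hc l).le
  rw [← hc, EReal.coe_le_coe_iff, div_mul_eq_mul_div, div_mul_eq_mul_div, ← add_div,
    div_le_iff₀ h3] at h
  linarith

variable (D) in
/-- Points of `Q` with last coordinates `y` lying above `w`. -/
def above (w : Fin d → Fin (n + 1) → EReal) (y : Fin d → ℝ) : Set (Fin d → Fin (n + 1) → ℝ) :=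
  {s | s ∈ D.Q ∧ (∀ i, s i (Fin.last n) = y i) ∧ ∀ i j, w i j ≤ s i j}

variable (D) in
/-- `w` starts at `a_{i0}`, ends at `y`, and is bounded by `min {a_{ij}, y_i}`. -/
structure IsAdmissible (w : Fin d → Fin (n + 1) → EReal) (y : Fin d → ℝ) : Prop where
  mem : ∀ i, y i ∈ Set.Icc (D.a i 0) (D.a i (Fin.last n))
  zero : ∀ i, w i 0 = D.a i 0
  last : ∀ i, w i (Fin.last n) = y i
  le : ∀ i j, w i j ≤ ((min (D.a i j) (y i) : ℝ) : EReal)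

variable {y : Fin d → ℝ} {c : Fin d → Fin (n + 1) → ℝ}

/-- The envelope of an admissible `w` is the least element of `D.above w y`. -/
theorem IsAdmissible.isLeast_above (hw : D.IsAdmissible w y)
    (hc : ∀ i j, (c i j : EReal) = D.envPoint w i j) : IsLeast (D.above w y) c := by
  have hwc : ∀ i j, w i j ≤ c i j := fun i j => (le_envPoint j).trans_eq (hc i j).symm
  have hmin : ∀ i j, c i j ≤ min (D.a i j) (y i) := by
    intro i j
    rw [← EReal.coe_le_coe_iff, hc]
    exact envPoint_le (gridConcave_min (D.a_strictMono i) (y i)) (min_eq_left (hw.mem i).1)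
      (fun _ => min_le_left _ _) (hw.le i) j
  have h0 : ∀ i, c i 0 = D.a i 0 := fun i =>
    le_antisymm ((hmin i 0).trans (min_le_left _ _))
      (EReal.coe_le_coe_iff.1 ((hw.zero i).symm.trans_le (hwc i 0)))
  have hl : ∀ i, c i (Fin.last n) = y i := fun i =>
    le_antisymm ((hmin i _).trans (min_le_right _ _))
      (EReal.coe_le_coe_iff.1 ((hw.last i).symm.trans_le (hwc i _)))
  refine ⟨⟨D.mem_Q_iff.2 fun i => (gridConcave_envPoint (hc i)).mem_gridSimplex (D.a_strictMono i)
    (h0 i) (fun j => (hmin i j).trans (min_le_left _ _))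
    (fun j => ((hmin i j).trans (min_le_right _ _)).trans_eq (hl i).symm), hl, hwc⟩, ?_⟩
  rintro s ⟨hs, -, hws⟩ i j
  rw [← EReal.coe_le_coe_iff, hc]
  exact envPoint_le (gridConcave_of_mem (D.a_strictMono i) (hs i))
    ((mem_gridSimplex_iff (D.a_strictMono i)).1 (hs i)).1
    (le_of_mem (D.a_strictMono i) (hs i)) (hws i) j

theorem IsAdmissible.isGreatest_concQ (hw : D.IsAdmissible w y)
    (hc : ∀ i j, (c i j : EReal) = D.envPoint w i j) (φ : (Fin d → ℝ) → ℝ) :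
    IsGreatest (D.concQ φ '' D.above w y) (D.concQ φ c) := by
  have h := hw.isLeast_above hc
  refine ⟨⟨c, h.1, rfl⟩, ?_⟩
  rintro _ ⟨s, hs, rfl⟩
  exact D.concQ_anti φ h.1.1 hs.1 (h.2 hs) fun i => (h.1.2.1 i).trans (hs.2.1 i).symm

theorem IsAdmissible.isGreatest_sSup (hw : D.IsAdmissible w y)
    (hc : ∀ i j, (c i j : EReal) = D.envPoint w i j) (φ : (Fin d → ℝ) → ℝ)
    {F : Set (Fin d → Fin (n + 1) → ℝ)} (hF : F = D.above w y) :
    IsGreatest (D.concQ φ '' F) (sSup (D.concQ φ '' F)) ∧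
      sSup (D.concQ φ '' F) = D.concQ φ c := by
  subst hF
  have h := hw.isGreatest_concQ hc φ
  rw [h.isLUB.sSup_eq]
  exact ⟨h, rfl⟩

/-! ### The incremental constraints as domination of `û`. -/

section Discretized

variable {v : Fin d → Fin (n + 1) → ℝ} {s : Fin d → Fin (n + 1) → ℝ} {t : (i : Fin d) → Fin (D.l i)}

theorem uHat_of_le {j : Fin (n + 1)} (h : j ≤ D.τ i (t i).castSucc) :
    D.uHat t y i j = D.a i j :=
  if_pos h

theorem uHat_of_ge {j : Fin (n + 1)} (h : D.τ i (t i).succ ≤ j) : D.uHat t y i j = y i := by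
  have h1 : ¬ j ≤ D.τ i (t i).castSucc :=
    not_le.2 ((D.τ_strictMono i Fin.castSucc_lt_succ).trans_le h)
  rw [uHat, if_neg h1, if_pos h]

/-- Lying above `û` only has to be checked at the two ends of the selected interval. -/
theorem uHat_le_iff (hs : s ∈ D.Q) (hlast : ∀ i, s i (Fin.last n) = y i) (i : Fin d) :
    (∀ j, D.uHat t y i j ≤ s i j) ↔
      D.a i (D.τ i (t i).castSucc) ≤ s i (D.τ i (t i).castSucc) ∧
        s i (Fin.last n) ≤ s i (D.τ i (t i).succ) := by
  constructor
  · intro h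
    have h1 := h (D.τ i (t i).castSucc)
    have h2 := h (D.τ i (t i).succ)
    rw [uHat_of_le le_rfl, EReal.coe_le_coe_iff] at h1
    rw [uHat_of_ge le_rfl, EReal.coe_le_coe_iff, ← hlast] at h2
    exact ⟨h1, h2⟩
  · rintro ⟨h1, h2⟩ j
    by_cases hj : j ≤ D.τ i (t i).castSucc
    · rw [uHat_of_le hj, EReal.coe_le_coe_iff]
      have := monotone_sub_of_mem (D.a_strictMono i) (hs i) hj
      simp only at this
      linarith
    · by_cases hj' : D.τ i (t i).succ ≤ j
      · rw [uHat_of_ge hj', EReal.coe_le_coe_iff, ← hlast]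
        exact h2.trans (monotone_of_mem (D.a_strictMono i) (hs i) hj')
      · rw [uHat, if_neg hj, if_neg hj']
        exact bot_le

/-- At an interior breakpoint, `δ = 1` makes `s` reach the grid value and `δ = 0` makes it reach its
last value. As `y` lies in the selected interval, either alternative yields the needed bound at each
end. -/
theorem uHat_le_of_incremental (hs : s ∈ D.Q) (hlast : ∀ i, s i (Fin.last n) = y i)
    (ht : ∀ i, y i ∈ Set.Icc (D.a i (D.τ i (t i).castSucc)) (D.a i (D.τ i (t i).succ)))
    {δ : (i : Fin d) → D.BinIdx i → ℝ} (hδ : D.Incremental (D.Z s) δ) (i : Fin d)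
    (j : Fin (n + 1)) : D.uHat t y i j ≤ s i j := by
  revert j
  have ha := D.a_strictMono i
  obtain ⟨⟨-, hz, -⟩, hδ⟩ := hδ i
  change Antitone (gridSlope (D.a i) (s i)) at hz
  have key : ∀ p : Fin (D.l i + 1), 0 < p → p < Fin.last (D.l i) →
      D.a i (D.τ i p) ≤ s i (D.τ i p) ∨ s i (Fin.last n) ≤ s i (D.τ i p) := by
    intro p hp hp'
    obtain ⟨h | h, h1, h2⟩ := hδ ⟨p, hp, hp'⟩
    · refine Or.inr (last_le_of_gridSlope_nonpos ha fun j hj => ?_)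
      have hlt : (D.τ i p : ℕ) + 1 < n + 1 := lt_of_le_of_lt hj j.2
      rw [h] at h2
      exact (hz (show (⟨D.τ i p + 1, hlt⟩ : Fin (n + 1)) ≤ j from hj)).trans (h2 ⟨_, hlt⟩ rfl)
    · rw [h] at h1
      exact Or.inl (le_of_one_le_gridSlope ha (hs i) h1)
  rw [uHat_le_iff hs hlast]
  constructor
  -- The extreme breakpoints carry no binary variable; there the bounds follow from `s i 0 = a i 0`
  -- and from reflexivity at the last index.
  · rcases eq_or_ne (t i).castSucc 0 with h | h
    · rw [h, D.τ_zero, ((mem_gridSimplex_iff ha).1 (hs i)).1]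
    · rcases key _ (Fin.pos_of_ne_zero h) (Fin.castSucc_lt_last _) with h | h
      · exact h
      · exact ((ht i).1.trans_eq (hlast i).symm).trans h
  · rcases eq_or_ne (t i).succ (Fin.last _) with h | h
    · rw [h, D.τ_last]
    · rcases key _ (Fin.succ_pos _) (lt_of_le_of_ne (Fin.le_last _) h) with h | h
      · exact ((hlast i).trans_le (ht i).2).trans h
      · exact h

theorem exists_incremental (hs : s ∈ D.Q) (hlast : ∀ i, s i (Fin.last n) = y i)
    (h : ∀ i j, D.uHat t y i j ≤ s i j) :
    ∃ δ : (i : Fin d) → D.BinIdx i → ℝ, D.Incremental (D.Z s) δ := by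
  -- Slopes equal 1 up to the lower end of the selected interval and 0 past its upper end, which
  -- dictates `δ`.
  refine ⟨fun i p => if p.1 ≤ (t i).castSucc then 1 else 0, fun i => ?_⟩
  have ha := D.a_strictMono i
  have hsi := (mem_gridSimplex_iff ha).1 (hs i)
  obtain ⟨h1, h2⟩ := (uHat_le_iff hs hlast i).1 (h i)
  refine ⟨⟨rfl, hsi.2⟩, fun p => ?_⟩
  change _ ∧ _ ≤ gridSlope (D.a i) (s i) _ ∧ ∀ j, _ → gridSlope (D.a i) (s i) j ≤ _
  by_cases hp : p.1 ≤ (t i).castSucc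
  · simp only [if_pos hp]
    exact ⟨Or.inr trivial, (one_le_gridSlope ha (hs i) h1).trans
      (hsi.2.1 ((D.τ_strictMono i).monotone hp)), fun j _ => hsi.2.1 (Fin.zero_le j)⟩
  · have hp' : (t i).succ ≤ p.1 := by
      simp only [Fin.le_def, Fin.val_succ, Fin.val_castSucc] at *; omega
    simp only [if_neg hp]
    refine ⟨Or.inl trivial, hsi.2.2.trans (hsi.2.1 (Fin.le_last _)), fun j hj => ?_⟩
    refine gridSlope_nonpos ha (hs i) h2 (((D.τ_strictMono i).monotone hp').trans_lt ?_)
    rw [Fin.lt_def]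
    omega

theorem isAdmissible_uHat
    (ht : ∀ i, y i ∈ Set.Icc (D.a i (D.τ i (t i).castSucc)) (D.a i (D.τ i (t i).succ))) :
    D.IsAdmissible (D.uHat t y) y where
  mem i := ⟨(D.a_mem_Icc i _).1.trans (ht i).1, (ht i).2.trans (D.a_mem_Icc i _).2⟩
  zero _ := uHat_of_le (Fin.zero_le _)
  last _ := uHat_of_ge (Fin.le_last _)
  le i j := by
    by_cases hj : j ≤ D.τ i (t i).castSucc
    · rw [uHat_of_le hj, EReal.coe_le_coe_iff]
      exact le_min le_rfl (((D.a_strictMono i).monotone hj).trans (ht i).1)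
    · by_cases hj' : D.τ i (t i).succ ≤ j
      · rw [uHat_of_ge hj', EReal.coe_le_coe_iff]
        exact le_min ((ht i).2.trans ((D.a_strictMono i).monotone hj')) le_rfl
      · rw [uHat, if_neg hj, if_neg hj']
        exact bot_le

theorem uBar_last : uBar v y i (Fin.last n) = y i :=
  if_pos rfl

theorem uBar_of_ne {j : Fin (n + 1)} (hj : j ≠ Fin.last n) : uBar v y i j = v i j :=
  if_neg hj

theorem uBar_ne (j : Fin (n + 1)) : uBar v y i j ≠ ⊥ ∧ uBar v y i j ≠ ⊤ := by
  unfold uBar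
  split_ifs <;> exact ⟨EReal.coe_ne_bot _, EReal.coe_ne_top _⟩

theorem isAdmissible_uBar (hn : 1 ≤ n)
    (hy : ∀ i, y i ∈ Set.Icc (D.a i 0) (D.a i (Fin.last n))) (hv : D.ValidAt v y) :
    D.IsAdmissible (uBar v y) y where
  mem := hy
  zero i := by
    -- Here `n ≥ 1` separates index 0 from the overwritten last index.
    rw [uBar_of_ne (by rw [Ne, Fin.ext_iff, Fin.val_zero, Fin.val_last]; omega), (hv i).1]
  last _ := uBar_last
  le i j := by
    rcases eq_or_ne j (Fin.last n) with rfl | hj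
    · rw [uBar_last, EReal.coe_le_coe_iff]
      exact le_min (hy i).2 le_rfl
    · rw [uBar_of_ne hj, EReal.coe_le_coe_iff]
      exact (hv i).2 j

/-- Overwriting the last entry loses nothing: validity already gives `v ≤ y` there, and `s` equals
`y`. -/
theorem uBar_le_iff (hlast : ∀ i, s i (Fin.last n) = y i) (hv : D.ValidAt v y) :
    (∀ i j, uBar v y i j ≤ s i j) ↔ v ≤ s := by
  refine forall_congr' fun i => forall_congr' fun j => ?_
  rcases eq_or_ne j (Fin.last n) with rfl | hj
  · rw [uBar_last, EReal.coe_le_coe_iff, hlast]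
    exact iff_of_true le_rfl (((hv i).2 _).trans (min_le_right _ _))
  · rw [uBar_of_ne hj, EReal.coe_le_coe_iff]

theorem IsAdmissible.sup {w' : Fin d → Fin (n + 1) → EReal} (hw : D.IsAdmissible w y)
    (hw' : D.IsAdmissible w' y) : D.IsAdmissible (fun i j => max (w i j) (w' i j)) y where
  mem := hw.mem
  zero i := by rw [hw.zero, hw'.zero, max_self]
  last i := by rw [hw.last, hw'.last, max_self]
  le i j := max_le (hw.le i j) (hw'.le i j)

end Discretized

end DiscretizationScheme

/-! ### The three relaxations. -/

theorem mainTheorem5 {m d n : ℕ} (hn : 1 ≤ n) (D : DiscretizationScheme d n)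
    (X : Set (Fin m → ℝ)) (f : (Fin m → ℝ) → Fin d → ℝ) (φ : (Fin d → ℝ) → ℝ)
    (u : (Fin m → ℝ) → Fin d → Fin (n + 1) → ℝ) (hu : OrderedOA D X f u)
    (W : Set ((Fin m → ℝ) × (Fin d → ℝ))) (hW : ∀ x ∈ X, (x, f x) ∈ W)
    (xbar : Fin m → ℝ) (fbar : Fin d → ℝ) (hmem : (xbar, fbar) ∈ W)
    (t : (i : Fin d) → Fin (D.l i))
    (ht : ∀ i, fbar i ∈ Set.Icc (D.a i (D.τ i (t i).castSucc)) (D.a i (D.τ i (t i).succ))) :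
    ∃ sbar shat sstar : Fin d → Fin (n + 1) → ℝ,
      (∀ i j, (sbar i j : EReal) =
        D.envPoint (DiscretizationScheme.uBar (u xbar) fbar) i j) ∧
      (∀ i j, (shat i j : EReal) = D.envPoint (D.uHat t fbar) i j) ∧
      (∀ i j, (sstar i j : EReal) = D.envPoint (D.uStar (u xbar) t fbar) i j) ∧
      (D.ValidAt (u xbar) fbar →
        IsGreatest (D.concQ φ '' D.feas u W xbar fbar) (D.relax φ u W xbar fbar) ∧
        D.relax φ u W xbar fbar = D.concQ φ sbar) ∧
      (IsGreatest (D.concQ φ '' D.feasHMinus W xbar fbar) (D.relaxHMinus φ W xbar fbar) ∧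
        D.relaxHMinus φ W xbar fbar = D.concQ φ shat) ∧
      (D.ValidAt (u xbar) fbar →
        IsGreatest (D.concQ φ '' D.feasH u W xbar fbar) (D.relaxH φ u W xbar fbar) ∧
        D.relaxH φ u W xbar fbar = D.concQ φ sstar) ∧
      D.relaxH φ u W xbar fbar ≤ D.relax φ u W xbar fbar ∧
      D.relaxH φ u W xbar fbar ≤ D.relaxHMinus φ W xbar fbar := by
  have hHat := DiscretizationScheme.isAdmissible_uHat ht
  have hHat_top : ∀ i j, D.uHat t fbar i j ≠ ⊤ := fun i j =>
    ((hHat.le i j).trans_lt (EReal.coe_lt_top _)).ne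
  have hStar_bot : ∀ i j, D.uStar (u xbar) t fbar i j ≠ ⊥ := fun i j =>
    ((bot_lt_iff_ne_bot.2 (DiscretizationScheme.uBar_ne j).1).trans_le (le_max_left _ _)).ne'
  choose sbar hsbar using fun i => DiscretizationScheme.exists_real_envPoint (D := D)
    (w := DiscretizationScheme.uBar (u xbar) fbar) (i := i)
    (DiscretizationScheme.uBar_ne _).1 (DiscretizationScheme.uBar_ne _).1
    fun j => (DiscretizationScheme.uBar_ne j).2
  choose shat hshat using fun i => DiscretizationScheme.exists_real_envPoint (D := D)
    (w := D.uHat t fbar) (i := i)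
    (by rw [hHat.zero]; exact EReal.coe_ne_bot _) (by rw [hHat.last]; exact EReal.coe_ne_bot _)
    (hHat_top i)
  choose sstar hsstar using fun i => DiscretizationScheme.exists_real_envPoint (D := D)
    (w := D.uStar (u xbar) t fbar) (i := i) (hStar_bot i _) (hStar_bot i _)
    fun j => (max_lt (lt_top_iff_ne_top.2 (DiscretizationScheme.uBar_ne j).2)
      (lt_top_iff_ne_top.2 (hHat_top i j))).ne
  refine ⟨sbar, shat, sstar, hsbar, hshat, hsstar, fun hv => ?_, ?_, fun hv => ?_, ?_, ?_⟩
  · refine (DiscretizationScheme.isAdmissible_uBar hn hHat.mem hv).isGreatest_sSup hsbar φ ?_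
    ext s
    constructor
    · rintro ⟨hQ, hl, hus, -⟩
      exact ⟨hQ, hl, (DiscretizationScheme.uBar_le_iff hl hv).2 hus⟩
    · rintro ⟨hQ, hl, hus⟩
      exact ⟨hQ, hl, (DiscretizationScheme.uBar_le_iff hl hv).1 hus, hmem⟩
  · refine hHat.isGreatest_sSup hshat φ ?_
    ext s
    constructor
    · rintro ⟨hQ, hl, ⟨δ, hδ⟩, -⟩
      exact ⟨hQ, hl, DiscretizationScheme.uHat_le_of_incremental hQ hl ht hδ⟩
    · rintro ⟨hQ, hl, hus⟩
      exact ⟨hQ, hl, DiscretizationScheme.exists_incremental hQ hl hus, hmem⟩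
  · refine ((DiscretizationScheme.isAdmissible_uBar hn hHat.mem hv).sup hHat).isGreatest_sSup
      hsstar φ ?_
    ext s
    constructor
    · rintro ⟨hQ, hl, ⟨δ, hδ⟩, hus, -⟩
      exact ⟨hQ, hl, fun i j => max_le ((DiscretizationScheme.uBar_le_iff hl hv).2 hus i j)
        (DiscretizationScheme.uHat_le_of_incremental hQ hl ht hδ i j)⟩
    · rintro ⟨hQ, hl, hus⟩
      exact ⟨hQ, hl, DiscretizationScheme.exists_incremental hQ hl
        fun i j => (le_max_right _ _).trans (hus i j),
        (DiscretizationScheme.uBar_le_iff hl hv).1 fun i j => (le_max_left _ _).trans (hus i j),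
        hmem⟩
  -- The comparisons are inclusions of feasible sets and need no validity of `u`.
  · exact sSup_le_sSup (Set.image_mono fun s ⟨hQ, hl, _, hus, hW⟩ => ⟨hQ, hl, hus, hW⟩)
  · exact sSup_le_sSup (Set.image_mono fun s ⟨hQ, hl, hδ, _, hW⟩ => ⟨hQ, hl, hδ, hW⟩)
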